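/- Let $A:D(A)\subseteq\mathcal H\to\mathcal H$ be a self-adjoint operator on the complex Hilbert space $\mathcal H$, with resolvent set $\rho(A)$, and let $\mathcal H_+$ be $D(A)$ with the inner product $\langle\phi,\psi\rangle_+=\langle A\phi,A\psi\rangle+\langle\phi,\psi\rangle$. A self-adjoint operator $\hat A$ on $\mathcal H$ is called a singular perturbation of $A$ if $\{\phi\in D(\hat A)\cap D(A):\hat A\phi=A\phi\}$ is dense in $\mathcal H$. For a Hilbert space $\mathfrak h$ and a bounded linear map $\tau:\mathcal H_+\to\mathfrak h$ with $\overline{\mathrm{Ker}(\tau)}=\mathcal H$ (closure in $\mathcal H$) and $\mathrm{Ran}(\tau)=\mathfrak h$, put, for $z\in\rho(A)$, $$R(z):=(-A+z)^{-1}:\mathcal H\to\mathcal H_+,\qquad G(z):=(\tau R(\bar z))^*:\mathfrak h\to\mathcal H,$$ $$R:=R(i),\qquad G:=G(-i),\qquad G_*:=\tfrac12\,(G(i)+G(-i)).$$ Corollary 3.2. Let $\hat A$ be a singular perturbation of $A$, and let $\mathcal N=\{\phi\in D(\hat A)\cap D(A):\hat A\phi=A\phi\}$. (1) There are a Hilbert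 space $\mathfrak h$, a map $\tau$ as above with $\mathrm{Ker}(\tau)=\mathcal N$, and a self-adjoint operator $\Theta$ on $\mathfrak h$ such that $$D(\hat A)=\{\phi\in\mathcal H:\ \phi=\phi_*+G_*\zeta_\phi,\ \phi_*\in D(A),\ \zeta_\phi\in D(\Theta),\ \Theta\zeta_\phi=\tau\phi_*\},\qquad \hat A\phi=A\phi_*+RG\,\zeta_\phi, \tag{$*$}$$ and $\hat A$ is a restriction of $A_{\mathcal N}^*$, where $A_{\mathcal N}$ is the restriction of $A$ to $\mathcal N$. (2) Whenever $\hat A$ is given by $(*)$ with a Hilbert space $\mathfrak h$, a map $\tau$ as above and a self-adjoint operator $\Theta$ on $\mathfrak h$, then for every $z\in\rho(A)$ $$z\in\rho(\hat A)\cap\rho(A)\iff 0\in\rho\bigl(\Theta+\tau(G_*-G(z))\bigr),$$ and for every $z\in\rho(\hat A)\cap\rho(A)$ $$(-\hat A+z)^{-1}=(-A+z)^{-1}+G(z)\bigl(\Theta+\tau(G_*-G(z))\bigr)^{-1}G(\bar z)^*.$$ -/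

import Mathlib

open scoped ComplexConjugate

universe u v

noncomputable section

namespace SingPert

section Resolvent

variable {E : Type*} [NormedAddCommGroup E] [NormedSpace ℂ E]

/-- `S` is a bounded, everywhere defined, two-sided inverse of the partially defined
operator `T`. -/
def IsBoundedInverse (T : E →ₗ.[ℂ] E) (S : E →L[ℂ] E) : Prop :=
  (∀ x : E, ∃ h : S x ∈ T.domain, T ⟨S x, h⟩ = x) ∧ ∀ x : T.domain, S (T x) = x

theorem IsBoundedInverse.unique {T : E →ₗ.[ℂ] E} {S S' : E →L[ℂ] E}
    (h : IsBoundedInverse T S) (h' : IsBoundedInverse T S') : S = S' := by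
  ext x
  obtain ⟨hx, e⟩ := h.1 x
  have := h'.2 ⟨S x, hx⟩
  rw [e] at this
  exact this.symm

open Classical in
/-- The bounded inverse `T⁻¹` of `T`, if there is one (and `0` otherwise). -/
def boundedInverse (T : E →ₗ.[ℂ] E) : E →L[ℂ] E :=
  if h : ∃ S, IsBoundedInverse T S then h.choose else 0

/-- The operator `-T + z`, with the domain of `T`. -/
def shift (T : E →ₗ.[ℂ] E) (z : ℂ) : E →ₗ.[ℂ] E where
  domain := T.domain
  toFun := z • T.domain.subtype - T.toFun

/-- The resolvent set `ρ(T)`: all `z` such that `-T + z` has a bounded inverse on the whole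
space. -/
def opResolventSet (T : E →ₗ.[ℂ] E) : Set ℂ :=
  {z | ∃ S, IsBoundedInverse (shift T z) S}

/-- The resolvent `(-T + z)⁻¹` for `z ∈ ρ(T)` (and `0` otherwise). -/
def opResolvent (T : E →ₗ.[ℂ] E) (z : ℂ) : E →L[ℂ] E :=
  boundedInverse (shift T z)

theorem isBoundedInverse_resolvent {T : E →ₗ.[ℂ] E} {z : ℂ} (hz : z ∈ opResolventSet T) :
    IsBoundedInverse (shift T z) (opResolvent T z) := by
  have h : ∃ S, IsBoundedInverse (shift T z) S := hz
  unfold opResolvent boundedInverse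
  rw [dif_pos h]
  exact h.choose_spec

theorem resolvent_mem_domain {T : E →ₗ.[ℂ] E} {z : ℂ} (hz : z ∈ opResolventSet T) (x : E) :
    opResolvent T z x ∈ T.domain :=
  ((isBoundedInverse_resolvent hz).1 x).1

theorem apply_resolvent {T : E →ₗ.[ℂ] E} {z : ℂ} (hz : z ∈ opResolventSet T) (x : E) :
    T ⟨opResolvent T z x, resolvent_mem_domain hz x⟩ = z • opResolvent T z x - x := by
  obtain ⟨h, e⟩ := (isBoundedInverse_resolvent hz).1 x
  have e' : z • opResolvent T z x - T ⟨opResolvent T z x, h⟩ = x := e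
  rw [eq_sub_iff_add_eq, ← eq_sub_iff_add_eq']
  exact e'.symm

end Resolvent

section GraphSpace

variable {H : Type*} [NormedAddCommGroup H] [InnerProductSpace ℂ H]

/-- The space `H₊`: the domain of `A` as a vector space of its own, to be equipped with the
graph inner product. -/
def GraphSpace (A : H →ₗ.[ℂ] H) : Type _ := A.domain

instance (A : H →ₗ.[ℂ] H) : AddCommGroup (GraphSpace A) :=
  inferInstanceAs (AddCommGroup A.domain)

instance (A : H →ₗ.[ℂ] H) : Module ℂ (GraphSpace A) :=
  inferInstanceAs (Module ℂ A.domain)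

/-- The identification of the underlying vector space of `H₊` with `D(A)`. -/
def toDomain (A : H →ₗ.[ℂ] H) : GraphSpace A ≃ₗ[ℂ] A.domain :=
  LinearEquiv.refl ℂ A.domain

/-- The graph inner product `⟨φ, ψ⟩₊ = ⟨A φ, A ψ⟩ + ⟨φ, ψ⟩`. -/
@[reducible] def graphCore (A : H →ₗ.[ℂ] H) : InnerProductSpace.Core ℂ (GraphSpace A) where
  inner φ ψ := inner ℂ (A (toDomain A φ)) (A (toDomain A ψ)) +
    inner ℂ (toDomain A φ : H) (toDomain A ψ : H)
  conj_inner_symm φ ψ := by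
    simp only [map_add, inner_conj_symm]
  re_inner_nonneg φ := by
    rw [map_add]
    exact add_nonneg inner_self_nonneg inner_self_nonneg
  add_left φ ψ χ := by
    simp only [map_add, LinearPMap.map_add, Submodule.coe_add, inner_add_left]
    ring
  smul_left φ ψ c := by
    simp only [map_smul, LinearPMap.map_smul, Submodule.coe_smul, inner_smul_left]
    ring
  definite φ h := by
    have h1 := congrArg Complex.re h
    rw [Complex.add_re, Complex.zero_re] at h1
    have h2 : 0 ≤ (inner ℂ (A (toDomain A φ)) (A (toDomain A φ))).re :=
      inner_self_nonneg (𝕜 := ℂ)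
    have h3 : 0 ≤ (inner ℂ (toDomain A φ : H) (toDomain A φ : H)).re :=
      inner_self_nonneg (𝕜 := ℂ)
    have h4 : (inner ℂ (toDomain A φ : H) (toDomain A φ : H)).re = 0 := by linarith
    have h5 : (toDomain A φ : H) = 0 := by
      have h6 := norm_sq_eq_re_inner (𝕜 := ℂ) (toDomain A φ : H)
      rw [RCLike.re_eq_complex_re, h4] at h6
      exact norm_eq_zero.1 (pow_eq_zero_iff two_ne_zero |>.1 h6)
    exact (toDomain A).map_eq_zero_iff.1 (Subtype.ext h5)

instance (A : H →ₗ.[ℂ] H) : NormedAddCommGroup (GraphSpace A) :=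
  (graphCore A).toNormedAddCommGroup

instance (A : H →ₗ.[ℂ] H) : InnerProductSpace ℂ (GraphSpace A) :=
  InnerProductSpace.ofCore (graphCore A).toCore

theorem graph_norm_sq (A : H →ₗ.[ℂ] H) (φ : GraphSpace A) :
    ‖φ‖ ^ 2 = ‖A (toDomain A φ)‖ ^ 2 + ‖(toDomain A φ : H)‖ ^ 2 := by
  rw [@norm_sq_eq_re_inner ℂ, @norm_sq_eq_re_inner ℂ _ _ _ _ (A (toDomain A φ)),
    @norm_sq_eq_re_inner ℂ _ _ _ _ (toDomain A φ : H), ← map_add]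
  rfl

/-- The resolvent `R(z) = (-A + z)⁻¹` as a bounded operator `H → H₊`, for `z ∈ ρ(A)` (and `0`
otherwise). -/
def R (A : H →ₗ.[ℂ] H) (z : ℂ) : H →L[ℂ] GraphSpace A :=
  open Classical in
  if hz : z ∈ opResolventSet A then
    LinearMap.mkContinuousOfExistsBound
      ((toDomain A).symm.toLinearMap ∘ₗ
        (opResolvent A z).toLinearMap.codRestrict A.domain (resolvent_mem_domain hz)) (by
      refine ⟨(‖z‖ * ‖opResolvent A z‖ + 1) + ‖opResolvent A z‖, fun x => ?_⟩
      set y := ((toDomain A).symm.toLinearMap ∘ₗ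
        (opResolvent A z).toLinearMap.codRestrict A.domain (resolvent_mem_domain hz)) x with hy
      have h1 : (toDomain A y : H) = opResolvent A z x := rfl
      have h2 : A (toDomain A y) = z • opResolvent A z x - x := apply_resolvent hz x
      have h3 : ‖opResolvent A z x‖ ≤ ‖opResolvent A z‖ * ‖x‖ := (opResolvent A z).le_opNorm x
      have h4 : ‖A (toDomain A y)‖ ≤ (‖z‖ * ‖opResolvent A z‖ + 1) * ‖x‖ := by
        rw [h2]
        refine (norm_sub_le _ _).trans ?_
        rw [norm_smul]
        nlinarith [mul_le_mul_of_nonneg_left h3 (norm_nonneg z)]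
      have h5 : ‖y‖ ≤ ‖A (toDomain A y)‖ + ‖(toDomain A y : H)‖ := by
        refine abs_le_of_sq_le_sq' ?_ (by positivity) |>.2
        rw [graph_norm_sq]
        nlinarith [mul_nonneg (norm_nonneg (A (toDomain A y)))
          (norm_nonneg (toDomain A y : H))]
      rw [h1] at h5
      linarith)
  else 0

end GraphSpace

section Boundary

variable {H : Type*} [NormedAddCommGroup H] [InnerProductSpace ℂ H] [CompleteSpace H]

/-- `Ahat` is a singular perturbation of the self-adjoint operator `A`: it is self-adjoint, and
the set `{φ ∈ D(Ahat) ∩ D(A) : Ahat φ = A φ}` is dense. -/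
def IsSingularPerturbation (A Ahat : H →ₗ.[ℂ] H) : Prop :=
  IsSelfAdjoint Ahat ∧ Dense (A.eqLocus Ahat : Set H)

variable {𝔥 : Type*} [NormedAddCommGroup 𝔥] [InnerProductSpace ℂ 𝔥] [CompleteSpace 𝔥]

/-- The kernel of `τ : H₊ → 𝔥` as a linear subspace of `H`. -/
def kerIn {A : H →ₗ.[ℂ] H} (τ : GraphSpace A →L[ℂ] 𝔥) : Submodule ℂ H :=
  τ.ker.map (A.domain.subtype ∘ₗ (toDomain A).toLinearMap)

/-- The standing assumptions on the bounded map `τ : H₊ → 𝔥`: its kernel is dense in `H`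
and its range is `𝔥`. -/
def IsAdmissible {A : H →ₗ.[ℂ] H} (τ : GraphSpace A →L[ℂ] 𝔥) : Prop :=
  Dense (kerIn τ : Set H) ∧ Function.Surjective τ

/-- `G(z) = (τ R(z̄))^*`. -/
def G {A : H →ₗ.[ℂ] H} (τ : GraphSpace A →L[ℂ] 𝔥) (z : ℂ) : 𝔥 →L[ℂ] H :=
  ContinuousLinearMap.adjoint (τ ∘L R A (conj z))

/-- `G_* = (G(i) + G(-i)) / 2`. -/
def Gstar {A : H →ₗ.[ℂ] H} (τ : GraphSpace A →L[ℂ] 𝔥) : 𝔥 →L[ℂ] H :=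
  (1 / 2 : ℂ) • (G τ Complex.I + G τ (-Complex.I))

/-- `τ (G_* - G(z))`, the composition of `τ` (with domain `D(A)`) after `G_* - G(z)`. Its domain
consists of all `ζ` with `(G_* - G(z)) ζ ∈ D(A)`; by the resolvent identity this is all of `𝔥` when
`A` is self-adjoint and `z ∈ ρ(A)`. -/
def Weyl {A : H →ₗ.[ℂ] H} (τ : GraphSpace A →L[ℂ] 𝔥) (z : ℂ) : 𝔥 →ₗ.[ℂ] 𝔥 where
  domain := A.domain.comap (Gstar τ - G τ z).toLinearMap
  toFun := τ.toLinearMap ∘ₗ (toDomain A).symm.toLinearMap ∘ₗ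
    (Gstar τ - G τ z).toLinearMap.restrict (fun _ h => h)

/-- `Ahat` is the operator `φ ↦ A φ_* + R G ζ`, where `R = R(i)` and `G = G(-i)`, on the domain
`{φ = φ_* + G_* ζ : φ_* ∈ D(A), ζ ∈ D(Θ), Θ ζ = τ φ_*}`. -/
def HasBoundaryForm {A : H →ₗ.[ℂ] H} (τ : GraphSpace A →L[ℂ] 𝔥) (Θ : 𝔥 →ₗ.[ℂ] 𝔥)
    (Ahat : H →ₗ.[ℂ] H) : Prop :=
  (∀ φ : H, φ ∈ Ahat.domain ↔
    ∃ (φs : GraphSpace A) (ζ : Θ.domain),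
      φ = (toDomain A φs : H) + Gstar τ ζ ∧ Θ ζ = τ φs) ∧
  ∀ (φ : Ahat.domain) (φs : GraphSpace A) (ζ : Θ.domain),
    (φ : H) = (toDomain A φs : H) + Gstar τ ζ → Θ ζ = τ φs →
      Ahat φ = A (toDomain A φs) +
        (toDomain A (R A Complex.I (G τ (-Complex.I) ζ)) : H)

end Boundary

end SingPert

end

open SingPert

noncomputable section

namespace SingPert

/-! ### Resolvents and bounded inverses read off from graphs. -/

section Graph

variable {E : Type*} [NormedAddCommGroup E] [NormedSpace ℂ E]

/-! Operators are handled through their graphs, so that domain conditions become membership in a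
subspace.

Existence. For `z = -i`, let `𝔥` be the orthogonal complement of `(-A + z)𝒩` and let `τ` be `-A + z`
followed by the projection onto `𝔥`. Since `Ahat` is closed, `(-A + z)𝒩` is closed, so `ker τ = 𝒩`.
For `(a, b)` in the graph of `Ahat`, the vector `a - R(i)(i a - b)` is orthogonal to `(-A - i)𝒩`,
hence lies in the range of `G(i)`; as `G_* - G(i)` maps into `D(A)`, this gives `a = φ + G_* ζ`
(`exists_decomp`). Testing against the dense set `𝒩` forces `b = Aφ + RGζ`. `Θ` is the relation
formed by the pairs `(ζ, τφ)`. Green's identity (`green`) turns self-adjointness of `Ahat` into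
self-adjointness of this relation, and `ker τ = 𝒩` makes it single-valued.

Resolvent. Moving `(G_* - G(z))ζ` into the regular part rewrites the graph of `Ahat` as the pairs
`(φ + G(z)ζ, Aφ + z G(z)ζ)` with `(Θ + τ(G_* - G(z)))ζ = τφ` (`HasBoundaryForm.mem_graph_iff_G`). On
such a pair `-Ahat + z` gives just `(-A + z)φ`, so inverting it amounts to taking `φ = R(z)x` and
solving for `ζ`. This is Krein's formula; bounded one-sided inverses of `G(z)` and `τR(z)` recover
the inverse on `𝔥` from the two resolvents. -/

theorem isBoundedInverse_iff_graph {T : E →ₗ.[ℂ] E} {S : E →L[ℂ] E} :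
    IsBoundedInverse T S ↔
      (∀ x, (S x, x) ∈ T.graph) ∧ ∀ a b, (a, b) ∈ T.graph → S b = a := by
  simp only [IsBoundedInverse, LinearPMap.mem_graph_iff]
  refine and_congr (forall_congr' fun x => ⟨?_, ?_⟩) ⟨?_, ?_⟩
  · rintro ⟨h, e⟩
    exact ⟨⟨S x, h⟩, rfl, e⟩
  · rintro ⟨⟨y, hy⟩, rfl, e⟩
    exact ⟨hy, e⟩
  · rintro h a b ⟨y, rfl, rfl⟩
    exact h y
  · intro h x
    exact h x (T x) ⟨x, rfl, rfl⟩

theorem mem_graph_shift {T : E →ₗ.[ℂ] E} {z : ℂ} {a b : E} :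
    (a, b) ∈ (shift T z).graph ↔ (a, z • a - b) ∈ T.graph := by
  have key : ∀ y : T.domain, (shift T z) y = z • (y : E) - T y := fun _ => rfl
  simp only [LinearPMap.mem_graph_iff]
  constructor
  · rintro ⟨y, rfl, rfl⟩
    exact ⟨y, rfl, by rw [key y]; simp⟩
  · rintro ⟨y, rfl, h⟩
    exact ⟨y, rfl, by rw [key y, h]; simp⟩

theorem isBoundedInverse_shift_iff {T : E →ₗ.[ℂ] E} {z : ℂ} {S : E →L[ℂ] E} :
    IsBoundedInverse (shift T z) S ↔
      (∀ x, (S x, z • S x - x) ∈ T.graph) ∧ ∀ a b, (a, b) ∈ T.graph → S (z • a - b) = a := by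
  simp only [isBoundedInverse_iff_graph, mem_graph_shift]
  refine and_congr Iff.rfl ⟨fun h a b hab => h a _ (by simpa using hab), fun h a b hab => ?_⟩
  simpa using h a _ hab

theorem resolvent_mem_graph {T : E →ₗ.[ℂ] E} {z : ℂ} (hz : z ∈ opResolventSet T) (x : E) :
    (opResolvent T z x, z • opResolvent T z x - x) ∈ T.graph :=
  (isBoundedInverse_shift_iff.1 (isBoundedInverse_resolvent hz)).1 x

theorem resolvent_apply_of_mem_graph {T : E →ₗ.[ℂ] E} {z : ℂ} (hz : z ∈ opResolventSet T)
    {a b : E} (h : (a, b) ∈ T.graph) : opResolvent T z (z • a - b) = a :=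
  (isBoundedInverse_shift_iff.1 (isBoundedInverse_resolvent hz)).2 a b h

theorem opResolvent_eq {T : E →ₗ.[ℂ] E} {z : ℂ} {S : E →L[ℂ] E}
    (h : IsBoundedInverse (shift T z) S) : opResolvent T z = S :=
  (isBoundedInverse_resolvent ⟨S, h⟩).unique h

theorem boundedInverse_eq {T : E →ₗ.[ℂ] E} {S : E →L[ℂ] E} (h : IsBoundedInverse T S) :
    boundedInverse T = S := by
  have h' : ∃ S, IsBoundedInverse T S := ⟨S, h⟩
  unfold boundedInverse
  rw [dif_pos h']
  exact h'.choose_spec.unique h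

/-- The shift at `0` is `-T`, which accounts for the sign. -/
theorem isBoundedInverse_shift_zero_iff {T : E →ₗ.[ℂ] E} {S : E →L[ℂ] E} :
    IsBoundedInverse (shift T 0) S ↔ IsBoundedInverse T (-S) := by
  rw [isBoundedInverse_shift_iff, isBoundedInverse_iff_graph]
  refine and_congr (forall_congr' fun x => ?_) (forall₃_congr fun a b _ => by simp)
  have : (-S x, x) = -(S x, (0 : ℂ) • S x - x) := by simp
  rw [neg_apply, this, neg_mem_iff]

/-- The first resolvent identity. -/
theorem resolvent_sub {T : E →ₗ.[ℂ] E} {z w : ℂ} (hz : z ∈ opResolventSet T)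
    (hw : w ∈ opResolventSet T) (x : E) :
    opResolvent T w x - opResolvent T z x =
      (z - w) • opResolvent T w (opResolvent T z x) := by
  have h := resolvent_apply_of_mem_graph hw (resolvent_mem_graph hz x)
  have e : w • opResolvent T z x - (z • opResolvent T z x - x) =
    x - (z - w) • opResolvent T z x := by module
  rw [e, map_sub, map_smul] at h
  rw [sub_eq_iff_eq_add, ← sub_eq_iff_eq_add', h]

end Graph

/-! ### Self-adjoint operators: adjoint resolvents and the points `±i`. -/

section SelfAdjoint

variable {H : Type*} [NormedAddCommGroup H] [InnerProductSpace ℂ H] [CompleteSpace H]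

theorem mem_graph_iff_of_isSelfAdjoint {A : H →ₗ.[ℂ] H} (hA : IsSelfAdjoint A) {x y : H} :
    (x, y) ∈ A.graph ↔ ∀ a b, (a, b) ∈ A.graph → inner ℂ b x = inner ℂ a y := by
  conv_lhs => rw [← LinearPMap.isSelfAdjoint_def.1 hA,
    LinearPMap.adjoint_graph_eq_graph_adjoint hA.dense_domain]
  simp only [Submodule.mem_adjoint_iff, sub_eq_zero]

theorem isSelfAdjoint_of_graph {A : H →ₗ.[ℂ] H} (hd : Dense (A.domain : Set H))
    (h : ∀ x y, (x, y) ∈ A.graph ↔ ∀ a b, (a, b) ∈ A.graph → inner ℂ b x = inner ℂ a y) :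
    IsSelfAdjoint A := by
  rw [LinearPMap.isSelfAdjoint_def]
  apply LinearPMap.eq_of_eq_graph
  rw [LinearPMap.adjoint_graph_eq_graph_adjoint hd]
  ext ⟨x, y⟩
  simp only [Submodule.mem_adjoint_iff, sub_eq_zero, h x y]

theorem inner_graph {A : H →ₗ.[ℂ] H} (hA : IsSelfAdjoint A) {x y a b : H}
    (h : (x, y) ∈ A.graph) (h' : (a, b) ∈ A.graph) : inner ℂ b x = inner ℂ a y :=
  (mem_graph_iff_of_isSelfAdjoint hA).1 h a b h'

theorem inner_resolvent {A : H →ₗ.[ℂ] H} (hA : IsSelfAdjoint A) {z : ℂ}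
    (hz : z ∈ opResolventSet A) (x : H) {a b : H} (h : (a, b) ∈ A.graph) :
    inner ℂ (conj z • a - b) (opResolvent A z x) = inner ℂ a x := by
  have := inner_graph hA (resolvent_mem_graph hz x) h
  rw [inner_sub_left, this, inner_smul_left, inner_sub_right, inner_smul_right]
  simp

theorem isBoundedInverse_adjoint_resolvent {A : H →ₗ.[ℂ] H} (hA : IsSelfAdjoint A) {z : ℂ}
    (hz : z ∈ opResolventSet A) :
    IsBoundedInverse (shift A (conj z)) (ContinuousLinearMap.adjoint (opResolvent A z)) := by
  rw [isBoundedInverse_shift_iff]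
  constructor
  · intro x
    rw [mem_graph_iff_of_isSelfAdjoint hA]
    intro a b hab
    have h := resolvent_apply_of_mem_graph hz hab
    rw [inner_sub_right, inner_smul_right, ContinuousLinearMap.adjoint_inner_right,
      ContinuousLinearMap.adjoint_inner_right]
    have h' := congrArg (fun t => inner ℂ t x) h
    simp only [map_sub, map_smul, inner_sub_left, inner_smul_left] at h'
    rw [← h']
    ring
  · intro a b hab
    refine ext_inner_right ℂ fun y => ?_
    rw [ContinuousLinearMap.adjoint_inner_left]
    exact inner_resolvent hA hz y hab

theorem conj_mem_opResolventSet {A : H →ₗ.[ℂ] H} (hA : IsSelfAdjoint A) {z : ℂ}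
    (hz : z ∈ opResolventSet A) : conj z ∈ opResolventSet A :=
  ⟨_, isBoundedInverse_adjoint_resolvent hA hz⟩

theorem adjoint_opResolvent {A : H →ₗ.[ℂ] H} (hA : IsSelfAdjoint A) {z : ℂ}
    (hz : z ∈ opResolventSet A) :
    ContinuousLinearMap.adjoint (opResolvent A z) = opResolvent A (conj z) :=
  (opResolvent_eq (isBoundedInverse_adjoint_resolvent hA hz)).symm

/-- By symmetry `⟨a, b⟩` is real, so the cross term has real part zero when `w = ±i`. -/
theorem norm_sq_shift_of_eq_I {A : H →ₗ.[ℂ] H} (hA : IsSelfAdjoint A) {w : ℂ}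
    (hw : w = Complex.I ∨ w = -Complex.I) {a b : H} (h : (a, b) ∈ A.graph) :
    ‖w • a - b‖ ^ 2 = ‖a‖ ^ 2 + ‖b‖ ^ 2 := by
  have h1 := inner_graph hA h h
  have h2 : (inner ℂ a b).im = 0 := by
    rw [← Complex.conj_eq_iff_im, inner_conj_symm, h1]
  rw [@norm_sub_sq ℂ, inner_smul_left, norm_smul]
  have h3 : inner ℂ a b = ((inner ℂ a b).re : ℂ) := by
    apply Complex.ext <;> simp [h2]
  rw [h3]
  rcases hw with rfl | rfl <;> simp

/-- The norm identity bounds `w - A` below on the complete graph, so its range is closed; a vector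
orthogonal to the range would be an eigenvector for `conj w`, which the same identity excludes. -/
theorem mem_opResolventSet_of_eq_I {A : H →ₗ.[ℂ] H} (hA : IsSelfAdjoint A) {w : ℂ}
    (hw : w = Complex.I ∨ w = -Complex.I) : w ∈ opResolventSet A := by
  have hcw : conj w = Complex.I ∨ conj w = -Complex.I := by
    rcases hw with rfl | rfl <;> simp
  have hcl : IsClosed (A.graph : Set (H × H)) := hA.isClosed
  have : CompleteSpace A.graph := hcl.completeSpace_coe
  let F : A.graph →L[ℂ] H := (w • ContinuousLinearMap.fst ℂ H H -
    ContinuousLinearMap.snd ℂ H H) ∘L A.graph.subtypeL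
  have hF : ∀ p : A.graph, F p = w • p.1.1 - p.1.2 := fun p => rfl
  have hnorm : ∀ p : A.graph, ‖p‖ ≤ ‖F p‖ := by
    intro p
    have h := norm_sq_shift_of_eq_I hA hw (a := p.1.1) (b := p.1.2) p.2
    rw [← hF] at h
    change max ‖p.1.1‖ ‖p.1.2‖ ≤ _
    refine max_le ?_ ?_ <;> refine abs_le_of_sq_le_sq' ?_ (norm_nonneg _) |>.2 <;> rw [h] <;>
      nlinarith [sq_nonneg ‖p.1.1‖, sq_nonneg ‖p.1.2‖]
  have hanti : AntilipschitzWith 1 F :=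
    F.antilipschitz_of_bound fun p => by simpa using hnorm p
  have hclosed : IsClosed (F.range : Set H) := 
    hanti.isClosed_range F.uniformContinuous
  have hrange : F.range = ⊤ := by
    have : CompleteSpace F.range := hclosed.completeSpace_coe
    rw [← Submodule.orthogonal_eq_bot_iff, Submodule.eq_bot_iff]
    intro y hy
    have h1 : (y, conj w • y) ∈ A.graph := by
      rw [mem_graph_iff_of_isSelfAdjoint hA]
      intro a b hab
      have := (Submodule.mem_orthogonal _ _).1 hy (F ⟨(a, b), hab⟩) ⟨_, rfl⟩
      rw [hF, inner_sub_left, inner_smul_left, sub_eq_zero] at this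
      rw [inner_smul_right, this]
    have h2 := norm_sq_shift_of_eq_I hA hcw h1
    simp only [sub_self, norm_zero] at h2
    have : ‖y‖ ^ 2 = 0 := by nlinarith [sq_nonneg ‖y‖, sq_nonneg ‖conj w • y‖]
    simpa using this
  have hinj : F.ker = ⊥ := LinearMap.ker_eq_bot.2 hanti.injective
  let e := ContinuousLinearEquiv.ofBijective F hinj hrange
  refine ⟨ContinuousLinearMap.fst ℂ H H ∘L A.graph.subtypeL ∘L (e.symm : H →L[ℂ] A.graph), ?_⟩
  rw [isBoundedInverse_shift_iff]
  constructor
  · intro x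
    have h1 : F (e.symm x) = x := e.apply_symm_apply x
    rw [hF] at h1
    have h2 : w • (e.symm x).1.1 - x = (e.symm x).1.2 := by
      nth_rw 2 [← h1]; simp
    change ((e.symm x).1.1, w • (e.symm x).1.1 - x) ∈ A.graph
    rw [h2]
    exact (e.symm x).2
  · intro a b hab
    have : e.symm (F ⟨(a, b), hab⟩) = ⟨(a, b), hab⟩ := e.symm_apply_apply _
    change (e.symm (F ⟨(a, b), hab⟩)).1.1 = a
    rw [this]

theorem I_mem_opResolventSet {A : H →ₗ.[ℂ] H} (hA : IsSelfAdjoint A) :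
    Complex.I ∈ opResolventSet A :=
  mem_opResolventSet_of_eq_I hA (Or.inl rfl)

theorem neg_I_mem_opResolventSet {A : H →ₗ.[ℂ] H} (hA : IsSelfAdjoint A) :
    -Complex.I ∈ opResolventSet A :=
  mem_opResolventSet_of_eq_I hA (Or.inr rfl)

end SelfAdjoint

/-! ### Bounded right inverses of surjections between Hilbert spaces. -/

section RightInverse

variable {E F : Type*} [NormedAddCommGroup E] [InnerProductSpace ℂ E] [CompleteSpace E]
  [NormedAddCommGroup F] [InnerProductSpace ℂ F] [CompleteSpace F]

/-- Restricted to the orthogonal complement of its kernel, `T` is a bijection, and the open mapping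
theorem applies. -/
theorem exists_rightInverse_of_surjective (T : E →L[ℂ] F) (hT : Function.Surjective T) :
    ∃ M : F →L[ℂ] E, ∀ y, T (M y) = y := by
  have : CompleteSpace T.ker := T.isClosed_ker.completeSpace_coe
  let f : T.kerᗮ →L[ℂ] F := T ∘L T.kerᗮ.subtypeL
  have hk : f.ker = ⊥ := by
    rw [Submodule.eq_bot_iff]
    intro x hx
    have h1 : (x : E) ∈ T.ker := hx
    have := (Submodule.mem_orthogonal _ _).1 x.2 x h1
    exact Subtype.ext (inner_self_eq_zero.1 this)
  have hr : f.range = ⊤ := by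
    rw [LinearMap.range_eq_top]
    intro y
    obtain ⟨x, rfl⟩ := hT y
    obtain ⟨u, hu, v, hv, rfl⟩ := T.ker.exists_add_mem_mem_orthogonal x
    refine ⟨⟨v, hv⟩, ?_⟩
    change T v = T (u + v)
    rw [map_add, show T u = 0 from hu, zero_add]
  let e := ContinuousLinearEquiv.ofBijective f hk hr
  exact ⟨T.kerᗮ.subtypeL ∘L (e.symm : F →L[ℂ] T.kerᗮ), fun y => e.apply_symm_apply y⟩

end RightInverse

/-! ### The resolvent as a map into `H₊`. -/

section GraphSpaceLemmas

variable {H : Type*} [NormedAddCommGroup H] [InnerProductSpace ℂ H]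

theorem mem_graph_iff_graphSpace {A : H →ₗ.[ℂ] H} {a b : H} :
    (a, b) ∈ A.graph ↔ ∃ φ : GraphSpace A, (toDomain A φ : H) = a ∧ A (toDomain A φ) = b :=
  A.mem_graph_iff

theorem graphSpace_mem_graph {A : H →ₗ.[ℂ] H} (φ : GraphSpace A) :
    ((toDomain A φ : H), A (toDomain A φ)) ∈ A.graph :=
  A.mem_graph _

theorem graphSpace_ext {A : H →ₗ.[ℂ] H} {φ ψ : GraphSpace A}
    (h : (toDomain A φ : H) = toDomain A ψ) : φ = ψ :=
  (toDomain A).injective (Subtype.ext h)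

theorem coe_R {A : H →ₗ.[ℂ] H} {z : ℂ} (hz : z ∈ opResolventSet A) (x : H) :
    (toDomain A (R A z x) : H) = opResolvent A z x := by
  unfold R
  rw [dif_pos hz]
  rfl

theorem R_apply {A : H →ₗ.[ℂ] H} {z : ℂ} (hz : z ∈ opResolventSet A) (φ : GraphSpace A) :
    R A z (z • (toDomain A φ : H) - A (toDomain A φ)) = φ :=
  graphSpace_ext <| by
    rw [coe_R hz, resolvent_apply_of_mem_graph hz (graphSpace_mem_graph φ)]

theorem apply_R {A : H →ₗ.[ℂ] H} {z : ℂ} (hz : z ∈ opResolventSet A) (x : H) :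
    A (toDomain A (R A z x)) = z • opResolvent A z x - x := by
  have h := resolvent_mem_graph hz x
  rw [← coe_R hz] at h ⊢
  exact LinearPMap.mem_graph_snd_inj A (graphSpace_mem_graph _) h rfl

end GraphSpaceLemmas

/-! ### The maps `G(z)` and their differences. -/

section Tau

variable {H : Type*} [NormedAddCommGroup H] [InnerProductSpace ℂ H] [CompleteSpace H]
variable {𝔥 : Type*} [NormedAddCommGroup 𝔥] [InnerProductSpace ℂ 𝔥] [CompleteSpace 𝔥]
variable {A : H →ₗ.[ℂ] H} {τ : GraphSpace A →L[ℂ] 𝔥}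

omit [CompleteSpace H] [CompleteSpace 𝔥] in
theorem surjective_comp_R (hτ : Function.Surjective τ) {z : ℂ} (hz : z ∈ opResolventSet A) :
    Function.Surjective (τ ∘L R A z) := fun η => by
  obtain ⟨φ, rfl⟩ := hτ η
  exact ⟨z • (toDomain A φ : H) - A (toDomain A φ), congrArg τ (R_apply hz φ)⟩

theorem adjoint_G (τ : GraphSpace A →L[ℂ] 𝔥) (z : ℂ) :
    ContinuousLinearMap.adjoint (G τ (conj z)) = τ ∘L R A z := by
  rw [G, ContinuousLinearMap.adjoint_adjoint, Complex.conj_conj]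

theorem inner_G (hA : IsSelfAdjoint A) (τ : GraphSpace A →L[ℂ] 𝔥) {z : ℂ}
    (hz : z ∈ opResolventSet A) (φ : GraphSpace A) (ζ : 𝔥) :
    inner ℂ (conj z • (toDomain A φ : H) - A (toDomain A φ)) (G τ z ζ) = inner ℂ (τ φ) ζ := by
  rw [G, ContinuousLinearMap.adjoint_inner_right, ContinuousLinearMap.comp_apply,
    R_apply (conj_mem_opResolventSet hA hz)]

theorem inner_apply_G (hA : IsSelfAdjoint A) (τ : GraphSpace A →L[ℂ] 𝔥) {z : ℂ}
    (hz : z ∈ opResolventSet A) (φ : GraphSpace A) (ζ : 𝔥) :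
    inner ℂ (A (toDomain A φ)) (G τ z ζ) =
      inner ℂ (toDomain A φ : H) (z • G τ z ζ) - inner ℂ (τ φ) ζ := by
  rw [← inner_G hA τ hz, inner_sub_left, inner_smul_left, inner_smul_right]
  simp

/-- `G(z)` has a bounded left inverse. -/
theorem exists_leftInverse_G (hA : IsSelfAdjoint A) (hτ : Function.Surjective τ) {z : ℂ}
    (hz : z ∈ opResolventSet A) : ∃ L : H →L[ℂ] 𝔥, ∀ ζ, L (G τ z ζ) = ζ := by
  obtain ⟨M, hM⟩ := exists_rightInverse_of_surjective _
    (surjective_comp_R hτ (conj_mem_opResolventSet hA hz))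
  refine ⟨ContinuousLinearMap.adjoint M, fun ζ => ext_inner_left ℂ fun η => ?_⟩
  rw [ContinuousLinearMap.adjoint_inner_right, G, ContinuousLinearMap.adjoint_inner_right, hM]

/-- This is the adjoint of the first resolvent identity at the conjugate points, composed with `τ`.
-/
theorem G_sub_G (hA : IsSelfAdjoint A) (τ : GraphSpace A →L[ℂ] 𝔥) {z w : ℂ}
    (hz : z ∈ opResolventSet A) (hw : w ∈ opResolventSet A) (ζ : 𝔥) :
    G τ w ζ - G τ z ζ = (z - w) • opResolvent A z (G τ w ζ) := by
  have hz' := conj_mem_opResolventSet hA hz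
  have hw' := conj_mem_opResolventSet hA hw
  refine ext_inner_left ℂ fun x => ?_
  have hR : R A (conj w) x - R A (conj z) x =
      (conj z - conj w) • R A (conj w) (opResolvent A (conj z) x) := by
    apply graphSpace_ext
    simp only [map_sub, map_smul, Submodule.coe_sub, Submodule.coe_smul, coe_R hz', coe_R hw']
    exact resolvent_sub hz' hw' x
  have e : inner ℂ x (opResolvent A z (G τ w ζ)) =
      inner ℂ (opResolvent A (conj z) x) (G τ w ζ) := by
    rw [← adjoint_opResolvent hA hz, ContinuousLinearMap.adjoint_inner_left]
  rw [inner_sub_right, inner_smul_right, e, G, G, ContinuousLinearMap.adjoint_inner_right,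
    ContinuousLinearMap.adjoint_inner_right, ContinuousLinearMap.adjoint_inner_right,
    ← inner_sub_left]
  simp only [ContinuousLinearMap.comp_apply]
  rw [← map_sub, hR, map_smul, inner_smul_left]
  simp

theorem G_sub_G_mem_graph (hA : IsSelfAdjoint A) (τ : GraphSpace A →L[ℂ] 𝔥) {z w : ℂ}
    (hz : z ∈ opResolventSet A) (hw : w ∈ opResolventSet A) (ζ : 𝔥) :
    (G τ w ζ - G τ z ζ, w • G τ w ζ - z • G τ z ζ) ∈ A.graph := by
  have h := A.graph.smul_mem (z - w) (resolvent_mem_graph hz (G τ w ζ))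
  rw [Prod.smul_mk, smul_sub, smul_comm, ← G_sub_G hA τ hz hw] at h
  convert h using 2
  module

theorem Gstar_apply (τ : GraphSpace A →L[ℂ] 𝔥) (ζ : 𝔥) :
    Gstar τ ζ = (1 / 2 : ℂ) • (G τ Complex.I ζ + G τ (-Complex.I) ζ) := rfl

theorem resolvent_I_G (hA : IsSelfAdjoint A) (τ : GraphSpace A →L[ℂ] 𝔥) (ζ : 𝔥) :
    (toDomain A (R A Complex.I (G τ (-Complex.I) ζ)) : H) =
      (Complex.I / 2) • (G τ Complex.I ζ - G τ (-Complex.I) ζ) := by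
  have h := G_sub_G hA τ (I_mem_opResolventSet hA) (neg_I_mem_opResolventSet hA) ζ
  rw [coe_R (I_mem_opResolventSet hA), ← neg_sub, h, smul_neg, smul_smul]
  have : Complex.I / 2 * (Complex.I - -Complex.I) = -1 := by
    ring_nf; simp
  rw [this, neg_smul, one_smul, neg_neg]

/-- Average `G_sub_G_mem_graph` over `w = ±i`: the mean of `w G(w)` is `(i/2)(G(i) - G(-i)) = RG`.
In particular `τ(G_* - G(z))` is defined on all of `𝔥`. -/
theorem Gstar_sub_G_mem_graph (hA : IsSelfAdjoint A) (τ : GraphSpace A →L[ℂ] 𝔥) {z : ℂ}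
    (hz : z ∈ opResolventSet A) (ζ : 𝔥) :
    (Gstar τ ζ - G τ z ζ,
      (toDomain A (R A Complex.I (G τ (-Complex.I) ζ)) : H) - z • G τ z ζ) ∈ A.graph := by
  have h1 := G_sub_G_mem_graph hA τ hz (I_mem_opResolventSet hA) ζ
  have h2 := G_sub_G_mem_graph hA τ hz (neg_I_mem_opResolventSet hA) ζ
  have h := A.graph.smul_mem (1 / 2 : ℂ) (add_mem h1 h2)
  rw [resolvent_I_G hA, Gstar_apply]
  convert h using 1
  simp only [Prod.mk_add_mk, Prod.smul_mk, Prod.mk.injEq]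
  constructor <;> module

theorem mem_graph_Weyl {z : ℂ} {ζ η : 𝔥} :
    (ζ, η) ∈ (Weyl τ z).graph ↔
      ∃ φ : GraphSpace A, (toDomain A φ : H) = Gstar τ ζ - G τ z ζ ∧ τ φ = η := by
  rw [LinearPMap.mem_graph_iff]
  constructor
  · rintro ⟨⟨y, hy⟩, rfl, rfl⟩
    exact ⟨(toDomain A).symm ⟨_, hy⟩, rfl, rfl⟩
  · rintro ⟨φ, h, rfl⟩
    refine ⟨⟨ζ, ?_⟩, rfl, ?_⟩
    · change Gstar τ ζ - G τ z ζ ∈ A.domain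
      rw [← h]
      exact (toDomain A φ).2
    · change τ ((toDomain A).symm ⟨Gstar τ ζ - G τ z ζ, _⟩) = τ φ
      congr 1
      exact graphSpace_ext h.symm

omit [CompleteSpace 𝔥] in
theorem mem_graph_add {Θ W : 𝔥 →ₗ.[ℂ] 𝔥} {ζ η : 𝔥} :
    (ζ, η) ∈ (Θ + W).graph ↔
      ∃ η₁ η₂, (ζ, η₁) ∈ Θ.graph ∧ (ζ, η₂) ∈ W.graph ∧ η = η₁ + η₂ := by
  constructor
  · intro h
    obtain ⟨⟨y, hy⟩, rfl, rfl⟩ := (Θ + W).mem_graph_iff.1 h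
    have hy' : y ∈ Θ.domain ⊓ W.domain := hy
    exact ⟨_, _, Θ.mem_graph ⟨y, hy'.1⟩, W.mem_graph ⟨y, hy'.2⟩, rfl⟩
  · rintro ⟨η₁, η₂, h1, h2, rfl⟩
    obtain ⟨⟨y, hy⟩, rfl, rfl⟩ := Θ.mem_graph_iff.1 h1
    obtain ⟨⟨y', hy'⟩, h, rfl⟩ := W.mem_graph_iff.1 h2
    obtain rfl : y' = y := h
    exact (Θ + W).mem_graph_iff.2 ⟨⟨y', hy, hy'⟩, rfl, rfl⟩

end Tau

/-! ### Krein's resolvent formula. -/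

section Krein

variable {H : Type*} [NormedAddCommGroup H] [InnerProductSpace ℂ H] [CompleteSpace H]
variable {𝔥 : Type*} [NormedAddCommGroup 𝔥] [InnerProductSpace ℂ 𝔥] [CompleteSpace 𝔥]
variable {A Ahat : H →ₗ.[ℂ] H} {τ : GraphSpace A →L[ℂ] 𝔥} {Θ : 𝔥 →ₗ.[ℂ] 𝔥}

theorem HasBoundaryForm.mem_graph_iff (h : HasBoundaryForm τ Θ Ahat) {a b : H} :
    (a, b) ∈ Ahat.graph ↔ ∃ (φ : GraphSpace A) (ζ : 𝔥), (ζ, τ φ) ∈ Θ.graph ∧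
      a = (toDomain A φ : H) + Gstar τ ζ ∧
      b = A (toDomain A φ) + (toDomain A (R A Complex.I (G τ (-Complex.I) ζ)) : H) := by
  constructor
  · intro hab
    obtain ⟨y, rfl, rfl⟩ := Ahat.mem_graph_iff.1 hab
    obtain ⟨φ, ζ, h1, h2⟩ := (h.1 _).1 y.2
    exact ⟨φ, ζ, Θ.mem_graph_iff.2 ⟨ζ, rfl, h2⟩, h1, h.2 y φ ζ h1 h2⟩
  · rintro ⟨φ, ζ, hΘ, rfl, rfl⟩
    obtain ⟨ξ, rfl, h2⟩ := Θ.mem_graph_iff.1 hΘ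
    have hd := (h.1 ((toDomain A φ : H) + Gstar τ ξ)).2 ⟨φ, ξ, rfl, h2⟩
    exact Ahat.mem_graph_iff.2 ⟨⟨_, hd⟩, rfl, h.2 ⟨_, hd⟩ φ ξ rfl h2⟩

/-- The boundary form of `Ahat` with respect to `G(z)` in place of `G_*`. -/
theorem HasBoundaryForm.mem_graph_iff_G (hA : IsSelfAdjoint A) (h : HasBoundaryForm τ Θ Ahat)
    {z : ℂ} (hz : z ∈ opResolventSet A) {a b : H} :
    (a, b) ∈ Ahat.graph ↔ ∃ (φ : GraphSpace A) (ζ : 𝔥), (ζ, τ φ) ∈ (Θ + Weyl τ z).graph ∧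
      a = (toDomain A φ : H) + G τ z ζ ∧ b = A (toDomain A φ) + z • G τ z ζ := by
  rw [h.mem_graph_iff]
  constructor
  · rintro ⟨φ, ζ, hΘ, rfl, rfl⟩
    obtain ⟨ψ, h1, h2⟩ := mem_graph_iff_graphSpace.1 (Gstar_sub_G_mem_graph hA τ hz ζ)
    refine ⟨φ + ψ, ζ, mem_graph_add.2 ⟨_, _, hΘ, mem_graph_Weyl.2 ⟨ψ, h1, rfl⟩, map_add _ _ _⟩,
      ?_, ?_⟩
    · rw [map_add, Submodule.coe_add, h1]; abel
    · rw [map_add, LinearPMap.map_add, h2]; abel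
  · rintro ⟨φ, ζ, hΘ, rfl, rfl⟩
    obtain ⟨η₁, η₂, hη₁, hη₂, e⟩ := mem_graph_add.1 hΘ
    obtain ⟨ψ', h1', rfl⟩ := mem_graph_Weyl.1 hη₂
    obtain ⟨ψ, h1, h2⟩ := mem_graph_iff_graphSpace.1 (Gstar_sub_G_mem_graph hA τ hz ζ)
    obtain rfl : ψ' = ψ := graphSpace_ext (h1'.trans h1.symm)
    refine ⟨φ - ψ', ζ, ?_, ?_, ?_⟩
    · rwa [map_sub, e, add_sub_cancel_right]
    · rw [map_sub, Submodule.coe_sub, h1]; abel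
    · rw [map_sub, LinearPMap.map_sub, h2]; abel

/-- A bounded inverse of `Θ + τ (G_* - G(z))` yields the resolvent of `Ahat` through Krein's
formula. -/
theorem HasBoundaryForm.isBoundedInverse_krein (hA : IsSelfAdjoint A)
    (h : HasBoundaryForm τ Θ Ahat) {z : ℂ} (hz : z ∈ opResolventSet A) {S : 𝔥 →L[ℂ] 𝔥}
    (hS : IsBoundedInverse (Θ + Weyl τ z) S) :
    IsBoundedInverse (shift Ahat z)
      (opResolvent A z + G τ z ∘L S ∘L ContinuousLinearMap.adjoint (G τ (conj z))) := by
  rw [isBoundedInverse_iff_graph] at hS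
  rw [isBoundedInverse_shift_iff, adjoint_G]
  simp only [add_apply, ContinuousLinearMap.comp_apply]
  constructor
  · intro x
    rw [h.mem_graph_iff_G hA hz]
    refine ⟨R A z x, S (τ (R A z x)), hS.1 _, ?_, ?_⟩
    · rw [coe_R hz]
    · rw [apply_R hz]; module
  · intro a b hab
    obtain ⟨φ, ζ, hΘ, rfl, rfl⟩ := (h.mem_graph_iff_G hA hz).1 hab
    have e : z • ((toDomain A φ : H) + G τ z ζ) - (A (toDomain A φ) + z • G τ z ζ) =
      z • (toDomain A φ : H) - A (toDomain A φ) := by module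
    rw [e, R_apply hz, hS.2 _ _ hΘ, resolvent_apply_of_mem_graph hz (graphSpace_mem_graph φ)]

theorem HasBoundaryForm.exists_isBoundedInverse (hA : IsSelfAdjoint A)
    (hτ : Function.Surjective τ) (h : HasBoundaryForm τ Θ Ahat) {z : ℂ}
    (hz : z ∈ opResolventSet A) (hz' : z ∈ opResolventSet Ahat) :
    ∃ S, IsBoundedInverse (Θ + Weyl τ z) S := by
  obtain ⟨L, hL⟩ := exists_leftInverse_G hA hτ hz
  obtain ⟨M, hM⟩ := exists_rightInverse_of_surjective _ (surjective_comp_R hτ hz)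
  -- Krein's formula predicts that the resolvent difference is `G(z) S τR(z)`; `L` cancels `G(z)`
  -- and `M` cancels `τR(z)`.
  refine ⟨L ∘L (opResolvent Ahat z - opResolvent A z) ∘L M, ?_⟩
  have key : ∀ (φ : GraphSpace A) (ζ : 𝔥), (ζ, τ φ) ∈ (Θ + Weyl τ z).graph →
      opResolvent Ahat z (z • (toDomain A φ : H) - A (toDomain A φ)) =
        (toDomain A φ : H) + G τ z ζ := by
    intro φ ζ hΘ
    have := resolvent_apply_of_mem_graph hz' ((h.mem_graph_iff_G hA hz).2 ⟨φ, ζ, hΘ, rfl, rfl⟩)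
    rw [← this]
    congr 1
    module
  have hval : ∀ η ζ, (ζ, η) ∈ (Θ + Weyl τ z).graph →
      L (opResolvent Ahat z (M η) - opResolvent A z (M η)) = ζ := by
    intro η ζ hΘ
    have hη : τ (R A z (M η)) = η := hM η
    rw [← hη] at hΘ
    have hx : z • (toDomain A (R A z (M η)) : H) - A (toDomain A (R A z (M η))) = M η := by
      rw [apply_R hz, coe_R hz]; abel
    have := key _ _ hΘ
    rw [hx, coe_R hz] at this
    rw [this, add_sub_cancel_left, hL]
  rw [isBoundedInverse_iff_graph]
  simp only [sub_apply, ContinuousLinearMap.comp_apply]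
  refine ⟨fun η => ?_, fun ζ η hΘ => hval η ζ hΘ⟩
  obtain ⟨φ, ζ, hΘ, h1, h2⟩ := (h.mem_graph_iff_G hA hz).1 (resolvent_mem_graph hz' (M η))
  have hx : z • (toDomain A φ : H) - A (toDomain A φ) = M η := by
    calc _ = z • ((toDomain A φ : H) + G τ z ζ) - (A (toDomain A φ) + z • G τ z ζ) := by module
      _ = M η := by rw [← h2, ← h1]; abel
  have hφ : τ φ = η := by
    rw [← R_apply hz φ, hx]
    exact hM η
  rw [hφ] at hΘ
  rwa [hval η ζ hΘ]

end Krein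

/-! ### Green's identity and the decomposition of `D(Ahat)`. -/

section Green

variable {H : Type*} [NormedAddCommGroup H] [InnerProductSpace ℂ H] [CompleteSpace H]
variable {𝔥 : Type*} [NormedAddCommGroup 𝔥] [InnerProductSpace ℂ 𝔥] [CompleteSpace 𝔥]
variable {A Ahat : H →ₗ.[ℂ] H} {τ : GraphSpace A →L[ℂ] 𝔥}

theorem mem_eqLocus_iff_graph {E : Type*} [AddCommGroup E] [Module ℂ E] {S T : E →ₗ.[ℂ] E}
    {a : E} : a ∈ S.eqLocus T ↔ ∃ b, (a, b) ∈ S.graph ∧ (a, b) ∈ T.graph := by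
  constructor
  · rintro ⟨hS, hT, e⟩
    exact ⟨S ⟨a, hS⟩, S.mem_graph ⟨a, hS⟩, by rw [e]; exact T.mem_graph ⟨a, hT⟩⟩
  · rintro ⟨b, hS, hT⟩
    obtain ⟨⟨x, hx⟩, rfl, hx'⟩ := S.mem_graph_iff.1 hS
    obtain ⟨⟨y, hy⟩, h, hy'⟩ := T.mem_graph_iff.1 hT
    obtain rfl : y = x := h
    exact ⟨hx, hy, hx'.trans hy'.symm⟩

omit [CompleteSpace H] [CompleteSpace 𝔥] in
theorem coe_mem_kerIn {φ : GraphSpace A} : (toDomain A φ : H) ∈ kerIn τ ↔ τ φ = 0 := by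
  constructor
  · rintro ⟨ψ, hψ, e⟩
    obtain rfl : ψ = φ := graphSpace_ext e
    exact hψ
  · intro h
    exact ⟨φ, h, rfl⟩

omit [CompleteSpace H] [CompleteSpace 𝔥] in
theorem mem_graph_of_tau_eq_zero (hker : kerIn τ = A.eqLocus Ahat) {φ : GraphSpace A}
    (h : τ φ = 0) : ((toDomain A φ : H), A (toDomain A φ)) ∈ Ahat.graph := by
  rw [← coe_mem_kerIn, hker, mem_eqLocus_iff_graph] at h
  obtain ⟨b, h1, h2⟩ := h
  rwa [LinearPMap.mem_graph_snd_inj A (graphSpace_mem_graph φ) h1 rfl]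

omit [CompleteSpace H] [CompleteSpace 𝔥] in
theorem tau_eq_zero_of_mem_graph (hker : kerIn τ = A.eqLocus Ahat) {φ : GraphSpace A}
    (h : ((toDomain A φ : H), A (toDomain A φ)) ∈ Ahat.graph) : τ φ = 0 := by
  rw [← coe_mem_kerIn, hker, mem_eqLocus_iff_graph]
  exact ⟨_, graphSpace_mem_graph φ, h⟩

/-- The vector `R G ζ`, with `R = R(i)` and `G = G(-i)`. -/
def RG (τ : GraphSpace A →L[ℂ] 𝔥) (ζ : 𝔥) : H :=
  (toDomain A (R A Complex.I (G τ (-Complex.I) ζ)) : H)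

theorem RG_eq (hA : IsSelfAdjoint A) (τ : GraphSpace A →L[ℂ] 𝔥) (ζ : 𝔥) :
    RG τ ζ = (Complex.I / 2) • (G τ Complex.I ζ - G τ (-Complex.I) ζ) :=
  resolvent_I_G hA τ ζ

theorem RG_mem_graph (hA : IsSelfAdjoint A) (τ : GraphSpace A →L[ℂ] 𝔥) (ζ : 𝔥) :
    (RG τ ζ, -Gstar τ ζ) ∈ A.graph := by
  have h := A.graph.smul_mem (Complex.I / 2) (G_sub_G_mem_graph hA τ
    (neg_I_mem_opResolventSet hA) (I_mem_opResolventSet hA) ζ)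
  rw [RG_eq hA, Gstar_apply]
  convert h using 1
  rw [Prod.smul_mk]
  congr 1
  have e : Complex.I / 2 * Complex.I = -(1 / 2) := by
    linear_combination (1 / 2 : ℂ) * Complex.I_mul_I
  rw [neg_smul, sub_neg_eq_add, ← smul_add, smul_smul, e, neg_smul]

theorem inner_RG_Gstar (hA : IsSelfAdjoint A) (τ : GraphSpace A →L[ℂ] 𝔥) (ζ ξ : 𝔥) :
    inner ℂ (RG τ ζ) (Gstar τ ξ) = inner ℂ (Gstar τ ζ) (RG τ ξ) := by
  have h := inner_graph hA (RG_mem_graph hA τ ξ) (RG_mem_graph hA τ ζ)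
  rw [inner_neg_left, inner_neg_right] at h
  exact (neg_injective h).symm

theorem inner_apply_Gstar (hA : IsSelfAdjoint A) (τ : GraphSpace A →L[ℂ] 𝔥) (φ : GraphSpace A)
    (ζ : 𝔥) : inner ℂ (A (toDomain A φ)) (Gstar τ ζ) =
      inner ℂ (toDomain A φ : H) (RG τ ζ) - inner ℂ (τ φ) ζ := by
  have h1 := inner_apply_G hA τ (I_mem_opResolventSet hA) φ ζ
  have h2 := inner_apply_G hA τ (neg_I_mem_opResolventSet hA) φ ζ
  rw [RG_eq hA, Gstar_apply, inner_smul_right, inner_add_right, h1, h2]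
  simp only [inner_smul_right, inner_sub_right]
  ring

/-- Green's identity. -/
theorem green (hA : IsSelfAdjoint A) (τ : GraphSpace A →L[ℂ] 𝔥) (φ ψ : GraphSpace A)
    (ζ ξ : 𝔥) :
    inner ℂ (A (toDomain A φ) + RG τ ζ) ((toDomain A ψ : H) + Gstar τ ξ) -
        inner ℂ ((toDomain A φ : H) + Gstar τ ζ) (A (toDomain A ψ) + RG τ ξ) =
      inner ℂ ζ (τ ψ) - inner ℂ (τ φ) ξ := by
  have h1 := inner_graph hA (graphSpace_mem_graph ψ) (graphSpace_mem_graph φ)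
  have h2 := inner_apply_Gstar hA τ φ ξ
  have h3 := congrArg conj (inner_apply_Gstar hA τ ψ ζ)
  rw [map_sub] at h3
  simp only [inner_conj_symm] at h3
  have h4 := inner_RG_Gstar hA τ ζ ξ
  simp only [inner_add_left, inner_add_right]
  linear_combination h1 + h2 - h3 + h4

/-- The action of `Ahat` in terms of the decomposition of its domain. -/
theorem eq_of_mem_graph_of_decomp (hA : IsSelfAdjoint A) (hAhat : IsSelfAdjoint Ahat)
    (hd : Dense (kerIn τ : Set H)) (hker : kerIn τ = A.eqLocus Ahat) {b : H}
    {φ : GraphSpace A} {ζ : 𝔥} (h : ((toDomain A φ : H) + Gstar τ ζ, b) ∈ Ahat.graph) :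
    b = A (toDomain A φ) + RG τ ζ := by
  refine hd.eq_of_inner_right ℂ ?_
  rintro _ ⟨ν, hν, rfl⟩
  have hν : τ ν = 0 := hν
  have h1 := inner_graph hAhat h (mem_graph_of_tau_eq_zero hker hν)
  have h2 := inner_apply_Gstar hA τ ν ζ
  have h3 := inner_graph hA (graphSpace_mem_graph φ) (graphSpace_mem_graph ν)
  rw [inner_add_right, h2, h3, hν, inner_zero_left, sub_zero, ← inner_add_right] at h1
  exact h1.symm

/-- `G(i)` is the adjoint of the surjection `τR(-i)`, so its range is the full orthogonal complement
of `ker τR(-i) = (-A - i) ker τ`. A right inverse `M` of `τR(-i)` gives the preimage `M^* χ`. -/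
theorem mem_range_G_I (hA : IsSelfAdjoint A) (hτ : Function.Surjective τ) {χ : H}
    (hχ : ∀ φ : GraphSpace A, τ φ = 0 →
      inner ℂ (-Complex.I • (toDomain A φ : H) - A (toDomain A φ)) χ = 0) :
    ∃ ζ, G τ Complex.I ζ = χ := by
  have hI := neg_I_mem_opResolventSet hA
  obtain ⟨M, hM⟩ := exists_rightInverse_of_surjective _ (surjective_comp_R hτ hI)
  refine ⟨ContinuousLinearMap.adjoint M χ, ext_inner_left ℂ fun x => ?_⟩
  rw [G, ContinuousLinearMap.adjoint_inner_right, ContinuousLinearMap.adjoint_inner_right,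
    Complex.conj_I]
  set y := M ((τ ∘L R A (-Complex.I)) x) with hy
  have h0 : τ (R A (-Complex.I) (x - y)) = 0 := by
    rw [map_sub, map_sub, sub_eq_zero]
    exact (hM _).symm
  have h1 := hχ _ h0
  rw [apply_R hI, coe_R hI, sub_sub_cancel, inner_sub_left, sub_eq_zero] at h1
  exact h1.symm

theorem exists_decomp (hA : IsSelfAdjoint A) (hAhat : IsSelfAdjoint Ahat)
    (hτ : Function.Surjective τ) (hker : kerIn τ = A.eqLocus Ahat) {a b : H}
    (h : (a, b) ∈ Ahat.graph) :
    ∃ (φ : GraphSpace A) (ζ : 𝔥), a = (toDomain A φ : H) + Gstar τ ζ := by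
  have hI := I_mem_opResolventSet hA
  obtain ⟨ζ, hζ⟩ := mem_range_G_I (χ := a - opResolvent A Complex.I (Complex.I • a - b)) hA hτ
    fun φ hφ => by
      have h1 := inner_graph hAhat h (mem_graph_of_tau_eq_zero hker hφ)
      have h2 := inner_resolvent hA hI (Complex.I • a - b) (graphSpace_mem_graph φ)
      rw [Complex.conj_I] at h2
      rw [inner_sub_right, h2, inner_sub_left, inner_sub_right, h1, inner_smul_left,
        inner_smul_right]
      simp
  -- `δ = (G_* - G(i))ζ` lies in `D(A)`, so `G(i)` can be traded for `G_*`.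
  obtain ⟨δ, hδ, -⟩ := mem_graph_iff_graphSpace.1 (Gstar_sub_G_mem_graph hA τ hI ζ)
  refine ⟨R A Complex.I (Complex.I • a - b) - δ, ζ, ?_⟩
  rw [map_sub, Submodule.coe_sub, coe_R hI, hδ, hζ]
  abel

end Green

/-! ### Construction of `Θ` from the boundary values. -/

section BoundaryOperator

variable {H : Type*} [NormedAddCommGroup H] [InnerProductSpace ℂ H] [CompleteSpace H]
variable {𝔥 : Type*} [NormedAddCommGroup 𝔥] [InnerProductSpace ℂ 𝔥] [CompleteSpace 𝔥]
variable {A Ahat : H →ₗ.[ℂ] H} {τ : GraphSpace A →L[ℂ] 𝔥}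

/-- The pairs of boundary values `(ζ, τ φ)` of the elements `φ + G_* ζ` of `D(Ahat)`. -/
def boundaryRelation (τ : GraphSpace A →L[ℂ] 𝔥) (Ahat : H →ₗ.[ℂ] H) : Submodule ℂ (𝔥 × 𝔥) where
  carrier := {p | ∃ φ : GraphSpace A, τ φ = p.2 ∧
    (toDomain A φ : H) + Gstar τ p.1 ∈ Ahat.domain}
  zero_mem' := ⟨0, by simp, by simp⟩
  add_mem' := by
    rintro p q ⟨φ, h1, h2⟩ ⟨ψ, h3, h4⟩
    refine ⟨φ + ψ, by rw [map_add, h1, h3, Prod.snd_add], ?_⟩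
    convert add_mem h2 h4 using 1
    rw [map_add, Submodule.coe_add, Prod.fst_add, map_add]
    abel
  smul_mem' := by
    rintro c p ⟨φ, h1, h2⟩
    refine ⟨c • φ, by rw [map_smul, h1, Prod.smul_snd], ?_⟩
    convert Ahat.domain.smul_mem c h2 using 1
    rw [map_smul, Submodule.coe_smul, Prod.smul_fst, map_smul, smul_add]

theorem mem_domain_iff_mem_boundaryRelation (hker : kerIn τ = A.eqLocus Ahat)
    {φ : GraphSpace A} {ζ : 𝔥} : (toDomain A φ : H) + Gstar τ ζ ∈ Ahat.domain ↔
      (ζ, τ φ) ∈ boundaryRelation τ Ahat := by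
  refine ⟨fun h => ⟨φ, rfl, h⟩, ?_⟩
  rintro ⟨ψ, h1, h2⟩
  have h3 : τ (φ - ψ) = 0 := by rw [map_sub, h1, sub_self]
  have h4 := Ahat.mem_domain_of_mem_graph (mem_graph_of_tau_eq_zero hker h3)
  rw [map_sub, Submodule.coe_sub] at h4
  convert add_mem h4 h2 using 1
  abel

theorem mem_graph_of_mem_boundaryRelation (hA : IsSelfAdjoint A) (hAhat : IsSelfAdjoint Ahat)
    (hd : Dense (kerIn τ : Set H)) (hker : kerIn τ = A.eqLocus Ahat) {φ : GraphSpace A} {ζ : 𝔥}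
    (h : (ζ, τ φ) ∈ boundaryRelation τ Ahat) :
    ((toDomain A φ : H) + Gstar τ ζ, A (toDomain A φ) + RG τ ζ) ∈ Ahat.graph := by
  have h1 := Ahat.mem_graph ⟨_, (mem_domain_iff_mem_boundaryRelation hker).2 h⟩
  rwa [eq_of_mem_graph_of_decomp hA hAhat hd hker h1] at h1

/-- By Green's identity, pairing boundary values in `𝔥` is pairing graph elements of `Ahat` in `H`;
surjectivity of `τ` lets every `η` be written as some `τψ`. -/
theorem mem_boundaryRelation_iff_adjoint (hA : IsSelfAdjoint A) (hAhat : IsSelfAdjoint Ahat)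
    (hτ : IsAdmissible τ) (hker : kerIn τ = A.eqLocus Ahat) {ξ η : 𝔥} :
    (ξ, η) ∈ boundaryRelation τ Ahat ↔
      ∀ ζ θ, (ζ, θ) ∈ boundaryRelation τ Ahat → inner ℂ θ ξ = inner ℂ ζ η := by
  obtain ⟨ψ, rfl⟩ := hτ.2 η
  constructor
  · rintro h ζ θ h'
    obtain ⟨φ, rfl⟩ := hτ.2 θ
    have h1 := inner_graph hAhat (mem_graph_of_mem_boundaryRelation hA hAhat hτ.1 hker h)
      (mem_graph_of_mem_boundaryRelation hA hAhat hτ.1 hker h')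
    have h2 := green hA τ φ ψ ζ ξ
    rw [h1, sub_self] at h2
    exact (sub_eq_zero.1 h2.symm).symm
  · intro h
    rw [← mem_domain_iff_mem_boundaryRelation hker]
    refine Ahat.mem_domain_of_mem_graph (y := A (toDomain A ψ) + RG τ ξ) ?_
    rw [mem_graph_iff_of_isSelfAdjoint hAhat]
    intro a b hab
    obtain ⟨φ, ζ, rfl⟩ := exists_decomp hA hAhat hτ.2 hker hab
    obtain rfl := eq_of_mem_graph_of_decomp hA hAhat hτ.1 hker hab
    have h1 := h ζ (τ φ) ((mem_domain_iff_mem_boundaryRelation hker).1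
      (Ahat.mem_domain_of_mem_graph hab))
    rw [← sub_eq_zero, green hA, h1, sub_self]

theorem snd_eq_zero_of_mem_boundaryRelation (hA : IsSelfAdjoint A) (hAhat : IsSelfAdjoint Ahat)
    (hτ : IsAdmissible τ) (hker : kerIn τ = A.eqLocus Ahat) {η : 𝔥}
    (h : (0, η) ∈ boundaryRelation τ Ahat) : η = 0 := by
  obtain ⟨φ, rfl⟩ := hτ.2 η
  have h1 := mem_graph_of_mem_boundaryRelation hA hAhat hτ.1 hker h
  have h2 : RG τ (0 : 𝔥) = 0 := by simp [RG]
  rw [h2, map_zero, add_zero, add_zero] at h1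
  exact tau_eq_zero_of_mem_graph hker h1

/-- The operator in `𝔥` whose graph consists of the boundary values of `D(Ahat)`. -/
def boundaryOperator (τ : GraphSpace A →L[ℂ] 𝔥) (Ahat : H →ₗ.[ℂ] H) : 𝔥 →ₗ.[ℂ] 𝔥 :=
  (boundaryRelation τ Ahat).toLinearPMap

theorem graph_boundaryOperator (hA : IsSelfAdjoint A) (hAhat : IsSelfAdjoint Ahat)
    (hτ : IsAdmissible τ) (hker : kerIn τ = A.eqLocus Ahat) :
    (boundaryOperator τ Ahat).graph = boundaryRelation τ Ahat := by
  refine Submodule.toLinearPMap_graph_eq _ ?_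
  rintro ⟨ζ, η⟩ h rfl
  exact snd_eq_zero_of_mem_boundaryRelation hA hAhat hτ hker h

theorem isSelfAdjoint_boundaryOperator (hA : IsSelfAdjoint A) (hAhat : IsSelfAdjoint Ahat)
    (hτ : IsAdmissible τ) (hker : kerIn τ = A.eqLocus Ahat) :
    IsSelfAdjoint (boundaryOperator τ Ahat) := by
  have hg := graph_boundaryOperator hA hAhat hτ hker
  refine isSelfAdjoint_of_graph ?_ fun x y => ?_
  -- If `η` is orthogonal to the domain, then `(0, η)` is in the adjoint relation, which is the
  -- relation itself, so single-valuedness gives `η = 0`.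
  · rw [Submodule.dense_iff_topologicalClosure_eq_top, Submodule.topologicalClosure_eq_top_iff,
      Submodule.eq_bot_iff]
    intro η hη
    refine snd_eq_zero_of_mem_boundaryRelation hA hAhat hτ hker
      ((mem_boundaryRelation_iff_adjoint hA hAhat hτ hker).2 fun ζ θ h => ?_)
    rw [← hg] at h
    rw [inner_zero_right]
    exact ((Submodule.mem_orthogonal _ _).1 hη ζ (LinearPMap.mem_domain_of_mem_graph h)).symm
  · rw [hg]
    exact mem_boundaryRelation_iff_adjoint hA hAhat hτ hker

theorem hasBoundaryForm_boundaryOperator (hA : IsSelfAdjoint A) (hAhat : IsSelfAdjoint Ahat)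
    (hτ : IsAdmissible τ) (hker : kerIn τ = A.eqLocus Ahat) :
    HasBoundaryForm τ (boundaryOperator τ Ahat) Ahat := by
  have hg := graph_boundaryOperator hA hAhat hτ hker
  constructor
  · intro φ
    constructor
    · intro h
      obtain ⟨ψ, ζ, rfl⟩ := exists_decomp hA hAhat hτ.2 hker (Ahat.mem_graph ⟨φ, h⟩)
      have h1 := (mem_domain_iff_mem_boundaryRelation hker).1 h
      rw [← hg] at h1
      obtain ⟨ζ', rfl, h2⟩ := LinearPMap.mem_graph_iff _ |>.1 h1
      exact ⟨ψ, ζ', rfl, h2⟩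
    · rintro ⟨ψ, ζ, rfl, h⟩
      rw [mem_domain_iff_mem_boundaryRelation hker, ← hg, ← h]
      exact LinearPMap.mem_graph _ ζ
  · rintro ⟨_, hφ⟩ ψ ζ rfl -
    exact eq_of_mem_graph_of_decomp hA hAhat hτ.1 hker (Ahat.mem_graph ⟨_, hφ⟩)

theorem le_adjoint_domRestrict (hAhat : IsSelfAdjoint Ahat) {N : Submodule ℂ H}
    (hd : Dense (N : Set H)) (hN : N = A.eqLocus Ahat) : Ahat ≤ (A.domRestrict N).adjoint := by
  have hle : N ≤ A.domain := by
    rw [hN]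
    rintro x ⟨hx, -⟩
    exact hx
  refine LinearPMap.IsFormalAdjoint.le_adjoint ?_ ?_
  · rwa [LinearPMap.domRestrict_domain, inf_eq_left.2 hle]
  · intro x y
    have h1 : (x : H) ∈ A.eqLocus Ahat := hN ▸ x.2.1
    obtain ⟨hxA, hxAhat, e⟩ := h1
    have e' : A.domRestrict N x = A ⟨x, hxA⟩ := LinearPMap.domRestrict_apply rfl
    rw [e', e]
    exact inner_graph hAhat (Ahat.mem_graph y) (Ahat.mem_graph ⟨x, hxAhat⟩)

end BoundaryOperator

/-! ### The concrete `𝔥` and `τ` with kernel `𝒩`. -/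

section DefectSpace

variable {H : Type*} [NormedAddCommGroup H] [InnerProductSpace ℂ H] [CompleteSpace H]

/-- The bounded operator `-A + z : H₊ → H`. -/
def shiftL (A : H →ₗ.[ℂ] H) (z : ℂ) : GraphSpace A →L[ℂ] H :=
  (shift A z).toFun ∘ₗ (toDomain A).toLinearMap |>.mkContinuous (‖z‖ + 1) fun φ => by
    have h1 : ‖(toDomain A φ : H)‖ ≤ ‖φ‖ := by
      refine abs_le_of_sq_le_sq' ?_ (norm_nonneg _) |>.2
      rw [graph_norm_sq]
      nlinarith [sq_nonneg ‖A (toDomain A φ)‖]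
    have h2 : ‖A (toDomain A φ)‖ ≤ ‖φ‖ := by
      refine abs_le_of_sq_le_sq' ?_ (norm_nonneg _) |>.2
      rw [graph_norm_sq]
      nlinarith [sq_nonneg ‖(toDomain A φ : H)‖]
    change ‖z • (toDomain A φ : H) - A (toDomain A φ)‖ ≤ _
    refine (norm_sub_le _ _).trans ?_
    rw [norm_smul]
    nlinarith [mul_le_mul_of_nonneg_left h1 (norm_nonneg z)]

omit [CompleteSpace H] in
theorem shiftL_apply (A : H →ₗ.[ℂ] H) (z : ℂ) (φ : GraphSpace A) :
    shiftL A z φ = z • (toDomain A φ : H) - A (toDomain A φ) := rfl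

/-- The range of `-A + z` on the set where `A` and `Ahat` agree. -/
def agreementRange (A Ahat : H →ₗ.[ℂ] H) (z : ℂ) : Submodule ℂ H :=
  (A.eqLocus Ahat).comap (opResolvent A z).toLinearMap

variable {A Ahat : H →ₗ.[ℂ] H} {z : ℂ}

omit [CompleteSpace H] in
theorem mem_agreementRange (hz : z ∈ opResolventSet A) {x : H} : x ∈ agreementRange A Ahat z ↔
    (opResolvent A z x, z • opResolvent A z x - x) ∈ Ahat.graph := by
  change opResolvent A z x ∈ A.eqLocus Ahat ↔ _
  rw [mem_eqLocus_iff_graph]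
  constructor
  · rintro ⟨b, h1, h2⟩
    rwa [← LinearPMap.mem_graph_snd_inj A h1 (resolvent_mem_graph hz x) rfl]
  · intro h
    exact ⟨_, resolvent_mem_graph hz x, h⟩

theorem isClosed_agreementRange (hAhat : IsSelfAdjoint Ahat) (hz : z ∈ opResolventSet A) :
    IsClosed (agreementRange A Ahat z : Set H) := by
  have h : (agreementRange A Ahat z : Set H) =
      (fun x => (opResolvent A z x, z • opResolvent A z x - x)) ⁻¹' Ahat.graph :=
    Set.ext fun _ => mem_agreementRange hz
  rw [h]
  exact IsClosed.preimage (by fun_prop) hAhat.isClosed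

/-- The projection of `(-A + z) φ` onto the orthogonal complement of the range of `-A + z` on the
set where `A` and `Ahat` agree. -/
def defectMap (A Ahat : H →ₗ.[ℂ] H) (z : ℂ) :
    GraphSpace A →L[ℂ] (agreementRange A Ahat z)ᗮ :=
  (agreementRange A Ahat z)ᗮ.orthogonalProjectionOnto ∘L shiftL A z

theorem surjective_defectMap (hz : z ∈ opResolventSet A) :
    Function.Surjective (defectMap A Ahat z) := fun η => by
  refine ⟨R A z η, ?_⟩
  have h : shiftL A z (R A z η) = η := by
    rw [shiftL_apply, apply_R hz, coe_R hz, sub_sub_cancel]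
  rw [defectMap, ContinuousLinearMap.comp_apply, h]
  exact Submodule.orthogonalProjectionOnto_mem_subspace_eq_self η

/-- Closedness of `agreementRange` makes it its own double orthogonal complement, so the projection
kills nothing beyond it. -/
theorem kerIn_defectMap (hAhat : IsSelfAdjoint Ahat) (hz : z ∈ opResolventSet A) :
    kerIn (defectMap A Ahat z) = A.eqLocus Ahat := by
  have hc : CompleteSpace (agreementRange A Ahat z) :=
    (isClosed_agreementRange hAhat hz).completeSpace_coe
  have key : ∀ φ : GraphSpace A, defectMap A Ahat z φ = 0 ↔
      (toDomain A φ : H) ∈ A.eqLocus Ahat := by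
    intro φ
    rw [defectMap, ContinuousLinearMap.comp_apply,
      Submodule.orthogonalProjectionOnto_eq_zero_iff, Submodule.orthogonal_orthogonal]
    change opResolvent A z (shiftL A z φ) ∈ A.eqLocus Ahat ↔ _
    rw [shiftL_apply, resolvent_apply_of_mem_graph hz (graphSpace_mem_graph φ)]
  ext x
  constructor
  · rintro ⟨φ, hφ, rfl⟩
    exact (key φ).1 hφ
  · intro hx
    obtain ⟨b, h1, -⟩ := mem_eqLocus_iff_graph.1 hx
    obtain ⟨φ, rfl, -⟩ := mem_graph_iff_graphSpace.1 h1
    exact coe_mem_kerIn.2 ((key φ).2 hx)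

end DefectSpace

end SingPert

end

open SingPert
theorem corollary3p2 {H : Type u} [NormedAddCommGroup H] [InnerProductSpace ℂ H] [CompleteSpace H]
    (A Ahat : H →ₗ.[ℂ] H) (hA : IsSelfAdjoint A) (hAhat : IsSingularPerturbation A Ahat) :
    (∃ (𝔥 : Type u) (_ : NormedAddCommGroup 𝔥) (_ : InnerProductSpace ℂ 𝔥) (_ : CompleteSpace 𝔥)
      (τ : GraphSpace A →L[ℂ] 𝔥) (Θ : 𝔥 →ₗ.[ℂ] 𝔥),
      IsAdmissible τ ∧ kerIn τ = A.eqLocus Ahat ∧ IsSelfAdjoint Θ ∧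
      Ahat ≤ (A.domRestrict (kerIn τ)).adjoint ∧ HasBoundaryForm τ Θ Ahat) ∧
    (∀ (𝔥 : Type v) [NormedAddCommGroup 𝔥] [InnerProductSpace ℂ 𝔥] [CompleteSpace 𝔥]
      (τ : GraphSpace A →L[ℂ] 𝔥) (Θ : 𝔥 →ₗ.[ℂ] 𝔥),
      IsAdmissible τ → IsSelfAdjoint Θ → HasBoundaryForm τ Θ Ahat →
      (∀ z ∈ opResolventSet A,
        (z ∈ opResolventSet Ahat ∩ opResolventSet A ↔ 0 ∈ opResolventSet (Θ + Weyl τ z))) ∧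
      (∀ z ∈ opResolventSet Ahat ∩ opResolventSet A,
        opResolvent Ahat z = opResolvent A z +
          G τ z ∘L boundedInverse (Θ + Weyl τ z) ∘L
            ContinuousLinearMap.adjoint (G τ (conj z)))) := by
  refine ⟨?_, fun 𝔥 _ _ _ τ Θ hτ _ h => ⟨fun z hz => ⟨fun hz' => ?_, ?_⟩, ?_⟩⟩
  · have hI := neg_I_mem_opResolventSet hA
    have hker := kerIn_defectMap hAhat.1 hI
    have hτ : IsAdmissible (defectMap A Ahat (-Complex.I)) :=
      ⟨by rw [hker]; exact hAhat.2, surjective_defectMap hI⟩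
    exact ⟨_, inferInstance, inferInstance, inferInstance, defectMap A Ahat (-Complex.I),
      boundaryOperator _ Ahat, hτ, hker, isSelfAdjoint_boundaryOperator hA hAhat.1 hτ hker,
      le_adjoint_domRestrict hAhat.1 hτ.1 hker,
      hasBoundaryForm_boundaryOperator hA hAhat.1 hτ hker⟩
  · obtain ⟨S, hS⟩ := h.exists_isBoundedInverse hA hτ.2 hz hz'.1
    exact ⟨-S, isBoundedInverse_shift_zero_iff.2 (by rwa [neg_neg])⟩
  · rintro ⟨S, hS⟩
    exact ⟨⟨_, h.isBoundedInverse_krein hA hz (isBoundedInverse_shift_zero_iff.1 hS)⟩, hz⟩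
  · rintro z ⟨hz', hz⟩
    obtain ⟨S, hS⟩ := h.exists_isBoundedInverse hA hτ.2 hz hz'
    rw [boundedInverse_eq hS]
    exact opResolvent_eq (h.isBoundedInverse_krein hA hz hS)
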